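/- Let $\mathcal X$ be a real separable Hilbert space and let $\mu=N(0,\mathcal K)$ be a centered Gaussian Borel probability measure on $\mathcal X$ with covariance operator $\mathcal K$. Let $\mathcal H(\mu)=\mathcal K^{1/2}\mathcal X$ be its Cameron--Martin space, with norm $\|u\|_{\mathcal H(\mu)}=\|\mathcal K^{-1/2}u\|_{\mathcal X}$ for $u\in\mathcal H(\mu)$ (where $\mathcal K^{-1/2}u$ is the preimage of $u$ under $\mathcal K^{1/2}$ of smallest norm) and $\|u\|_{\mathcal H(\mu)}=+\infty$ for $u\in\mathcal X\setminus\mathcal H(\mu)$. Let $\phi_1,\dots,\phi_N\in\mathcal X^\ast$ be bounded linear functionals, let $\boldsymbol\phi(u)=(\phi_1(u),\dots,\phi_N(u))\in\mathbb R^N$, and let $F:\mathbb R^N\to\mathbb R^M$ be locally Lipschitz: for every $r>0$ there is $L(r)>0$ such that $|F(z_1)-F(z_2)|\le L(r)|z_1-z_2|$ for all $z_1,z_2\in\mathbb{R}^N$ with $|z_1|,|z_2|<r$ (Euclidean norms). Put $G=F\circ\boldsymbol\phi$, and let $\mu_0^y=\mu(\mathrm du\mid G(u)=y)$ denote the conditional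 of $\mu$ given $G(u)=y$. For $y\in\mathbb R^M$, a point $u^\dagger\in\mathcal X$ is called a conditional mode of $\mu_0^y$ if $y\in\operatorname{supp}G_\sharp\mu$, $G(u^\dagger)=y$ and $$\lim_{r\downarrow0}\frac{\mu(B_r(u^\dagger))}{\sup_{v\in G^{-1}(y)}\mu(B_r(v))}=1,$$ where $B_r(v)$ is the open ball in $\mathcal X$ of radius $r$ centered at $v$. (This notion depends only on $\mu$, $G$ and $y$.) Let $y\in F(\boldsymbol\phi(\mathcal H(\mu)))$. Then a point $u\in\mathcal X$ is a conditional mode of $\mu_0^y$ if and only if it is a (global) minimizer of the problem $$\min_{v\in\mathcal X}\ \|v\|_{\mathcal H(\mu)}\quad\text{subject to}\quad F(\boldsymbol\phi(v))=y.$$ -/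

import Mathlib

open MeasureTheory ProbabilityTheory Filter Set
open scoped Topology ENNReal RealInnerProductSpace

noncomputable section

/-! ### The positive square root of a positive operator on a real Hilbert space -/

section PosSqrt

variable {X : Type*} [NormedAddCommGroup X] [InnerProductSpace ℝ X] [CompleteSpace X]

/-- The iteration `Y₀ = 0`, `Yₙ₊₁ = (B + Yₙ²) / 2`, whose limit `Y` satisfies `(1 - Y)² = 1 - B`. -/
def sqrtIter {A : Type*} [Ring A] [Algebra ℝ A] (B : A) : ℕ → A
  | 0 => 0
  | n + 1 => (2⁻¹ : ℝ) • (B + sqrtIter B n * sqrtIter B n)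

theorem sqrtIter_one_le (n : ℕ) :
    0 ≤ sqrtIter (1 : ℝ) n ∧ sqrtIter (1 : ℝ) n ≤ 1 := by
  induction n with
  | zero => simp [sqrtIter]
  | succ n ih =>
    obtain ⟨h0, h1⟩ := ih
    simp only [sqrtIter, smul_eq_mul]
    constructor <;> nlinarith

theorem norm_sqrtIter_le {B : X →L[ℝ] X} (hB : ‖B‖ ≤ 1) (n : ℕ) :
    ‖sqrtIter B n‖ ≤ sqrtIter (1 : ℝ) n := by
  induction n with
  | zero => simp [sqrtIter]
  | succ n ih =>
    have h := norm_mul_le (sqrtIter B n) (sqrtIter B n)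
    have h2 := norm_add_le B (sqrtIter B n * sqrtIter B n)
    simp only [sqrtIter, smul_eq_mul, norm_smul, norm_inv, Real.norm_ofNat]
    nlinarith [norm_nonneg (sqrtIter B n)]

theorem norm_sqrtIter_sub_le {B : X →L[ℝ] X} (hB : ‖B‖ ≤ 1) (n : ℕ) :
    ‖sqrtIter B (n + 1) - sqrtIter B n‖ ≤ sqrtIter (1 : ℝ) (n + 1) - sqrtIter (1 : ℝ) n := by
  induction n with
  | zero => simpa [sqrtIter, norm_smul] using hB
  | succ n ih =>
    set P := sqrtIter B (n + 1) with hP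
    set Q := sqrtIter B n with hQ
    have e : sqrtIter B (n + 1 + 1) - P = (2⁻¹ : ℝ) • (P * (P - Q) + (P - Q) * Q) := by
      have h1 : sqrtIter B (n + 1 + 1) = (2⁻¹ : ℝ) • (B + P * P) := rfl
      have h2 : P = (2⁻¹ : ℝ) • (B + Q * Q) := rfl
      rw [h1]
      nth_rw 3 [h2]
      rw [← smul_sub]
      congr 1
      noncomm_ring
    have e' : sqrtIter (1 : ℝ) (n + 1 + 1) =
        2⁻¹ * (1 + sqrtIter (1 : ℝ) (n + 1) * sqrtIter (1 : ℝ) (n + 1)) := rfl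
    have e'' : sqrtIter (1 : ℝ) (n + 1) =
        2⁻¹ * (1 + sqrtIter (1 : ℝ) n * sqrtIter (1 : ℝ) n) := rfl
    have hPn := norm_sqrtIter_le hB (n + 1)
    have hQn := norm_sqrtIter_le hB n
    rw [← hP] at hPn
    rw [← hQ] at hQn
    have b1 : ‖P * (P - Q)‖ ≤ sqrtIter (1 : ℝ) (n + 1) *
        (sqrtIter (1 : ℝ) (n + 1) - sqrtIter (1 : ℝ) n) :=
      (norm_mul_le _ _).trans (mul_le_mul hPn ih (norm_nonneg _) (sqrtIter_one_le _).1)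
    have b2 : ‖(P - Q) * Q‖ ≤ (sqrtIter (1 : ℝ) (n + 1) - sqrtIter (1 : ℝ) n) *
        sqrtIter (1 : ℝ) n :=
      (norm_mul_le _ _).trans (mul_le_mul ih hQn (norm_nonneg _) ((norm_nonneg _).trans ih))
    have b3 := norm_add_le (P * (P - Q)) ((P - Q) * Q)
    rw [e, norm_smul, e']
    simp only [norm_inv, Real.norm_ofNat]
    nlinarith

theorem isSelfAdjoint_sqrtIter {B : X →L[ℝ] X} (hB : IsSelfAdjoint B) (n : ℕ) :
    IsSelfAdjoint (sqrtIter B n) := by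
  induction n with
  | zero => exact IsSelfAdjoint.zero _
  | succ n ih =>
    have h : IsSelfAdjoint (sqrtIter B n * sqrtIter B n) := by
      rw [isSelfAdjoint_iff, star_mul, ih.star_eq]
    exact IsSelfAdjoint.smul (IsSelfAdjoint.all (2⁻¹ : ℝ)) (hB.add h)

theorem exists_posSqrt_of_norm_le {A : X →L[ℝ] X} (hA : A.IsPositive) (hA1 : ‖A‖ ≤ 1) :
    ∃ S : X →L[ℝ] X, S.IsPositive ∧ S ∘L S = A := by
  have hB : ‖1 - A‖ ≤ 1 := by
    refine ContinuousLinearMap.opNorm_le_bound _ zero_le_one fun x => ?_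
    have h1 : 0 ≤ ⟪A (x - A x), x - A x⟫ := hA.inner_nonneg_left _
    have h2 : ⟪A (A x), A x⟫ ≤ ‖A x‖ ^ 2 := by
      have h3 := real_inner_le_norm (A (A x)) (A x)
      have h4 : ‖A (A x)‖ ≤ ‖A x‖ := by
        simpa using A.le_of_opNorm_le hA1 (A x)
      nlinarith [norm_nonneg (A x)]
    have h5 : ⟪A (A x), x⟫ = ‖A x‖ ^ 2 := by
      rw [hA.inner_left_eq_inner_right, real_inner_self_eq_norm_sq]
    simp only [map_sub, inner_sub_left, inner_sub_right, h5, real_inner_self_eq_norm_sq] at h1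
    have h6 : ‖x - A x‖ ^ 2 ≤ ‖x‖ ^ 2 := by
      rw [norm_sub_sq_real, real_inner_comm]
      nlinarith [sq_nonneg ‖A x‖, real_inner_comm x (A x)]
    simpa using le_of_sq_le_sq h6 (norm_nonneg x)
  have hBsa : IsSelfAdjoint (1 - A) := (IsSelfAdjoint.one _).sub hA.isSelfAdjoint
  have hmono : Monotone (sqrtIter (1 : ℝ)) := monotone_nat_of_le_succ fun n =>
    sub_nonneg.1 ((norm_nonneg _).trans (norm_sqrtIter_sub_le hB n))
  have hsum : Summable fun n => sqrtIter (1 : ℝ) (n + 1) - sqrtIter (1 : ℝ) n := by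
    refine summable_of_sum_range_le (c := 1) (fun n => sub_nonneg.2 (hmono n.le_succ)) fun n => ?_
    rw [Finset.sum_range_sub]
    simpa [sqrtIter] using (sqrtIter_one_le n).2
  have hc : CauchySeq (sqrtIter (1 - A)) :=
    cauchySeq_of_dist_le_of_summable _
      (fun n => by rw [dist_comm, dist_eq_norm]; exact norm_sqrtIter_sub_le hB n) hsum
  obtain ⟨Y, hY⟩ := cauchySeq_tendsto_of_complete hc
  have hYn : ‖Y‖ ≤ 1 := le_of_tendsto hY.norm
    (Eventually.of_forall fun n => (norm_sqrtIter_le hB n).trans (sqrtIter_one_le n).2)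
  have hYsa : IsSelfAdjoint Y := by
    have h := (continuous_star.tendsto Y).comp hY
    refine tendsto_nhds_unique h (hY.congr fun n => ?_)
    exact (isSelfAdjoint_sqrtIter hBsa n).star_eq.symm
  have hfix : Y = (2⁻¹ : ℝ) • (1 - A + Y * Y) := by
    refine tendsto_nhds_unique ((tendsto_add_atTop_iff_nat 1).2 hY) ?_
    exact ((tendsto_const_nhds.add (hY.mul hY)).const_smul _)
  refine ⟨1 - Y, ?_, ?_⟩
  · rw [ContinuousLinearMap.isPositive_iff']
    refine ⟨(IsSelfAdjoint.one _).sub hYsa, fun x => ?_⟩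
    have h1 := real_inner_le_norm (Y x) x
    have h2 : ‖Y x‖ ≤ ‖x‖ := by simpa using Y.le_of_opNorm_le hYn x
    simp only [sub_apply, one_apply_eq_self, inner_sub_left,
      real_inner_self_eq_norm_sq]
    nlinarith [norm_nonneg x]
  · have h2 : (2 : ℝ) • Y = 1 - A + Y * Y := by
      nth_rw 1 [hfix]
      rw [smul_smul]
      norm_num
    change (1 - Y) * (1 - Y) = A
    have h3 : (1 - Y) * (1 - Y) = 1 - (2 : ℝ) • Y + Y * Y := by
      rw [two_smul]
      noncomm_ring
    rw [h3, h2]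
    noncomm_ring

/-- Every positive operator on a real Hilbert space has a positive square root. -/
theorem exists_posSqrt {K : X →L[ℝ] X} (hK : K.IsPositive) :
    ∃ S : X →L[ℝ] X, S.IsPositive ∧ S ∘L S = K := by
  set c : ℝ := ‖K‖ + 1 with hc
  have hc0 : 0 < c := by positivity
  obtain ⟨S, hS, hSS⟩ := exists_posSqrt_of_norm_le (A := c⁻¹ • K)
    (hK.smul_of_nonneg (inv_nonneg.2 hc0.le)) (by
      rw [norm_smul, Real.norm_of_nonneg (inv_nonneg.2 hc0.le), inv_mul_le_iff₀ hc0]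
      linarith)
  refine ⟨Real.sqrt c • S, hS.smul_of_nonneg (Real.sqrt_nonneg c), ?_⟩
  rw [ContinuousLinearMap.smul_comp, ContinuousLinearMap.comp_smul, hSS, smul_smul, smul_smul,
    Real.mul_self_sqrt hc0.le, mul_inv_cancel₀ hc0.ne', one_smul]

end PosSqrt

section Definitions

variable {X : Type*} [NormedAddCommGroup X] [InnerProductSpace ℝ X] [CompleteSpace X]
  [MeasurableSpace X] [BorelSpace X]

/-- The positive square root `𝒦^{1/2}` of the covariance operator `𝒦` of `μ`
(for the covariance operator of a centered measure,
`⟪𝒦 x, y⟫ = ∫ z, ⟪x, z⟫ * ⟪y, z⟫ ∂μ`). -/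
def covarianceSqrt (μ : Measure X) : X →L[ℝ] X :=
  (exists_posSqrt (K := covarianceOperator μ) isPositive_covarianceOperator).choose

theorem covarianceSqrt_isPositive (μ : Measure X) : (covarianceSqrt μ).IsPositive :=
  (exists_posSqrt (K := covarianceOperator μ) isPositive_covarianceOperator).choose_spec.1

theorem covarianceSqrt_comp_self (μ : Measure X) :
    covarianceSqrt μ ∘L covarianceSqrt μ = covarianceOperator μ :=
  (exists_posSqrt (K := covarianceOperator μ) isPositive_covarianceOperator).choose_spec.2

/-- The Cameron–Martin space `ℋ(μ) = 𝒦^{1/2} X` of a centered Gaussian measure `μ = N(0, 𝒦)`. -/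
def cameronMartinSpace (μ : Measure X) : Submodule ℝ X :=
  LinearMap.range (covarianceSqrt μ).toLinearMap

/-- The Cameron–Martin norm `‖u‖_{ℋ(μ)} = ‖𝒦^{-1/2} u‖`, extended by `∞` to `X ∖ ℋ(μ)`.
When `𝒦^{1/2}` is not injective, `𝒦^{-1/2} u` is the preimage of `u` of smallest norm. -/
def cameronMartinNorm (μ : Measure X) (u : X) : ℝ≥0∞ :=
  ⨅ (w : X) (_ : covarianceSqrt μ w = u), ‖w‖ₑ

/-- `u` is a conditional mode of `ν(du ∣ T(u) = y)`. As in the usual definition, the small balls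
are measured by `ν` itself and their centers are restricted to the fibre `T⁻¹(y)`. -/
def IsConditionalMode {Y : Type*} [TopologicalSpace Y] [MeasurableSpace Y]
    (ν : Measure X) (T : X → Y) (y : Y) (u : X) : Prop :=
  y ∈ (ν.map T).support ∧ u ∈ T ⁻¹' {y} ∧
    Tendsto (fun r : ℝ => ν (Metric.ball u r) / ⨆ v ∈ T ⁻¹' {y}, ν (Metric.ball v r))
      (𝓝[>] 0) (𝓝 1)

/-- The vector of observations `φ(u) = (φ₁(u), …, φ_N(u))`. -/
def observation {N : ℕ} (φ : Fin N → StrongDual ℝ X) (u : X) : EuclideanSpace ℝ (Fin N) :=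
  WithLp.toLp 2 fun i => φ i u

/-- Lipschitz on every ball around the origin. -/
def LipschitzOnBalls {E E' : Type*} [NormedAddCommGroup E] [NormedAddCommGroup E']
    (F : E → E') : Prop :=
  ∀ r > 0, ∃ L > 0, ∀ z₁ ∈ Metric.ball (0 : E) r, ∀ z₂ ∈ Metric.ball (0 : E) r,
    ‖F z₁ - F z₂‖ ≤ L * ‖z₁ - z₂‖

/-- `u` is a global minimizer of `‖·‖_{ℋ(μ)}` over all points of `X` with `T(u) = y`. -/
def IsConstrainedMinimizer {Y : Type*} (μ : Measure X) (T : X → Y) (y : Y) (u : X) : Prop :=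
  T u = y ∧ ∀ v : X, T v = y → cameronMartinNorm μ u ≤ cameronMartinNorm μ v

end Definitions

end

/-!
For `w : X` let `ℓ_w(v) = ⟪w, v⟫ - ⟪𝒦 w, w⟫ / 2`. By the Cameron–Martin formula, `exp ℓ_w`
integrates over `B_r(v)` to `μ(B_r(v - 𝒦 w))`, which is at most `μ(B_r(0))` by Anderson's
inequality. Hence `μ(B_r(v)) ≤ exp(r‖w‖ - ℓ_w(v)) μ(B_r(0))`. By Legendre duality, the supremum of
`ℓ_w(v)` over `w` is `‖v‖²_{ℋ(μ)} / 2`, so that the upper bound matches, as `r → 0`, the lower bound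
`μ(B_r(v)) ≥ exp(-‖v‖²_{ℋ(μ)} / 2) μ(B_r(0))`. A conditional mode is therefore a minimizer.

For the converse the upper bound is needed uniformly on the fibre. Since `ℓ_w` is weakly continuous,
finitely many `w` suffice on the weakly compact intersection of the fibre with a large ball, while
outside that ball `w = v / ‖v‖` gives a bound that decays exponentially in `‖v‖`.
-/

section WeakTopology

variable {E : Type*} [NormedAddCommGroup E] [InnerProductSpace ℝ E]

theorem continuous_inner_toWeakSpace_symm (w : E) :
    Continuous fun x : WeakSpace ℝ E => ⟪w, (toWeakSpace ℝ E).symm x⟫ :=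
  WeakBilin.eval_continuous _ (innerSL ℝ w)

variable [CompleteSpace E]

theorem isCompact_toWeakSpace_symm_preimage_closedBall (r : ℝ) :
    IsCompact ((toWeakSpace ℝ E).symm ⁻¹' Metric.closedBall 0 r) := by
  set J : WeakDual ℝ E → WeakSpace ℝ E := fun f =>
    toWeakSpace ℝ E ((InnerProductSpace.toDual ℝ E).symm (WeakDual.toStrongDual f)) with hJ
  have hJc : Continuous J := by
    refine WeakBilin.continuous_of_continuous_eval _ fun l => ?_
    refine (WeakDual.eval_continuous ((InnerProductSpace.toDual ℝ E).symm l)).congr fun f => ?_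
    change WeakDual.toStrongDual f _ = l ((InnerProductSpace.toDual ℝ E).symm _)
    rw [← InnerProductSpace.toDual_symm_apply (x := (InnerProductSpace.toDual ℝ E).symm l),
      ← InnerProductSpace.toDual_symm_apply, real_inner_comm]
  convert (WeakDual.isCompact_closedBall (0 : StrongDual ℝ E) r).image hJc
  ext x
  refine ⟨fun hx => ⟨StrongDual.toWeakDual
    (InnerProductSpace.toDual ℝ E ((toWeakSpace ℝ E).symm x)), ?_, ?_⟩, ?_⟩
  · simpa using hx
  · simp [hJ]
  · rintro ⟨f, hf, rfl⟩
    simpa [hJ] using hf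

variable {F : Type*} [NormedAddCommGroup F] [InnerProductSpace ℝ F]

theorem isClosed_image_closedBall_zero (T : E →L[ℝ] F) (r : ℝ) :
    IsClosed (T '' Metric.closedBall 0 r) := by
  have hweak : IsClosed (WeakSpace.map T '' ((toWeakSpace ℝ E).symm ⁻¹' Metric.closedBall 0 r)) :=
    ((isCompact_toWeakSpace_symm_preimage_closedBall r).image
      (WeakSpace.map T).continuous).isClosed
  exact hweak.preimage (toWeakSpaceCLM ℝ F).continuous

theorem mem_image_closedBall_of_forall_inner_le [CompleteSpace F] {T : E →L[ℝ] F} {z : F} {a : ℝ}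
    (ha : 0 ≤ a) (h : ∀ l, ⟪l, z⟫ ≤ a * ‖T.adjoint l‖) : z ∈ T '' Metric.closedBall 0 a := by
  by_contra hz
  obtain ⟨f, c, hfc, hcf⟩ := geometric_hahn_banach_closed_point
    ((convex_closedBall (0 : E) a).linear_image T.toLinearMap)
    (isClosed_image_closedBall_zero T a) hz
  set l := (InnerProductSpace.toDual ℝ F).symm f
  have hf (y : F) : f y = ⟪l, y⟫ := InnerProductSpace.toDual_symm_apply.symm
  set x := (a / ‖T.adjoint l‖) • T.adjoint l with hx
  have hxa : x ∈ Metric.closedBall 0 a := by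
    rw [mem_closedBall_zero_iff, hx, norm_smul, norm_div, norm_norm, Real.norm_of_nonneg ha,
      div_mul_eq_mul_div, mul_div_assoc]
    exact mul_le_of_le_one_right ha (div_self_le_one _)
  have hfx : f (T x) = a * ‖T.adjoint l‖ := by
    rw [hf, ← ContinuousLinearMap.adjoint_inner_left, hx, inner_smul_right,
      real_inner_self_eq_norm_sq]
    rcases eq_or_ne ‖T.adjoint l‖ 0 with h0 | h0
    · simp [h0]
    · field_simp
  have := hfc _ (mem_image_of_mem T hxa)
  linarith [h l, hf z]

theorem mem_image_closedBall_of_forall_inner_sub_le [CompleteSpace F] {T : E →L[ℝ] F} {z : F}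
    {a : ℝ} (ha : 0 ≤ a) (h : ∀ l, ⟪l, z⟫ - ‖T.adjoint l‖ ^ 2 / 2 ≤ a ^ 2 / 2) :
    z ∈ T '' Metric.closedBall 0 a := by
  refine mem_image_closedBall_of_forall_inner_le ha fun l => ?_
  have hdiscrim : discrim (‖T.adjoint l‖ ^ 2 / 2) (-⟪l, z⟫) (a ^ 2 / 2) ≤ 0 := by
    refine discrim_le_zero fun t => ?_
    have := h (t • l)
    rw [map_smul, norm_smul, inner_smul_left, mul_pow, Real.norm_eq_abs, sq_abs,
      RCLike.conj_to_real] at this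
    linarith
  rw [discrim] at hdiscrim
  exact le_of_sq_le_sq (by linarith) (by positivity)

end WeakTopology

section CameronMartinNorm

variable {E : Type*} [NormedAddCommGroup E] [InnerProductSpace ℝ E] [CompleteSpace E]
  [MeasurableSpace E] [BorelSpace E] {μ : Measure E}

theorem inner_covarianceOperator_self (w : E) :
    ⟪covarianceOperator μ w, w⟫ = ‖covarianceSqrt μ w‖ ^ 2 := by
  rw [← covarianceSqrt_comp_self, ContinuousLinearMap.comp_apply,
    (covarianceSqrt_isPositive μ).inner_left_eq_inner_right, real_inner_self_eq_norm_sq]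

theorem inner_covarianceOperator_self_nonneg (w : E) : 0 ≤ ⟪covarianceOperator μ w, w⟫ :=
  inner_covarianceOperator_self (μ := μ) w ▸ sq_nonneg _

theorem adjoint_covarianceSqrt : (covarianceSqrt μ).adjoint = covarianceSqrt μ :=
  (covarianceSqrt_isPositive μ).isSelfAdjoint.adjoint_eq

theorem cameronMartinNorm_covarianceSqrt_le (x : E) :
    cameronMartinNorm μ (covarianceSqrt μ x) ≤ ‖x‖ₑ :=
  iInf₂_le (f := fun w (_ : covarianceSqrt μ w = covarianceSqrt μ x) => ‖w‖ₑ) x rfl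

theorem cameronMartinNorm_ne_top {u : E} (hu : u ∈ cameronMartinSpace μ) :
    cameronMartinNorm μ u ≠ ∞ := by
  obtain ⟨x, rfl⟩ := hu
  exact ((cameronMartinNorm_covarianceSqrt_le x).trans_lt enorm_lt_top).ne

/-- For `μ = N(0, 𝒦)`, the logarithm at `x` of the density with respect to `μ` of the shift of `μ`
by `𝒦 w`. It is affine in `x`, so that it can be used both for integrating over small balls and as
a weakly continuous lower bound of half the squared Cameron–Martin norm. -/
noncomputable def logShiftDensity (μ : Measure E) (w x : E) : ℝ :=
  ⟪w, x⟫ - ⟪covarianceOperator μ w, w⟫ / 2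

theorem cameronMartinNorm_le_ofReal {v : E} {a : ℝ} (ha : 0 ≤ a)
    (h : ∀ w, logShiftDensity μ w v ≤ a ^ 2 / 2) : cameronMartinNorm μ v ≤ ENNReal.ofReal a := by
  obtain ⟨x, hx, rfl⟩ : v ∈ covarianceSqrt μ '' Metric.closedBall 0 a := by
    refine mem_image_closedBall_of_forall_inner_sub_le ha fun w => ?_
    rw [adjoint_covarianceSqrt, ← inner_covarianceOperator_self]
    exact h w
  refine (cameronMartinNorm_covarianceSqrt_le x).trans ?_
  rw [← ofReal_norm]
  exact ENNReal.ofReal_le_ofReal (mem_closedBall_zero_iff.1 hx)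

theorem exists_lt_logShiftDensity {v : E} {a b : ℝ} (ha : 0 ≤ a)
    (hv : ENNReal.ofReal a ≤ cameronMartinNorm μ v) (hb : b < a ^ 2 / 2) :
    ∃ w, b < logShiftDensity μ w v := by
  by_contra! hle
  have hb0 : 0 ≤ b := by simpa [logShiftDensity] using hle 0
  have hvb : cameronMartinNorm μ v ≤ ENNReal.ofReal √(2 * b) := by
    refine cameronMartinNorm_le_ofReal (Real.sqrt_nonneg _) fun w => (hle w).trans_eq ?_
    rw [Real.sq_sqrt (by linarith)]
    ring
  have hab : a ≤ √(2 * b) := (ENNReal.ofReal_le_ofReal_iff (Real.sqrt_nonneg _)).1 (hv.trans hvb)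
  rw [Real.le_sqrt ha (by linarith)] at hab
  linarith

end CameronMartinNorm

section ExponentialMoments

variable {E : Type*} [NormedAddCommGroup E] [InnerProductSpace ℝ E] [CompleteSpace E]
  [SecondCountableTopology E] [MeasurableSpace E] [BorelSpace E]

theorem measure_ext_of_integral_exp_inner {μ ν : Measure E} [IsFiniteMeasure μ]
    [IsFiniteMeasure ν] (hμ : ∀ a, Integrable (fun x => Real.exp ⟪a, x⟫) μ)
    (h : ∀ a, ∫ x, Real.exp ⟪a, x⟫ ∂μ = ∫ x, Real.exp ⟪a, x⟫ ∂ν) : μ = ν := by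
  have hmass : μ.real univ = ν.real univ := by simpa using h 0
  have hzero : μ = 0 ↔ ν = 0 := by
    rw [← Measure.measure_univ_eq_zero, ← measureReal_eq_zero_iff, hmass, measureReal_eq_zero_iff,
      Measure.measure_univ_eq_zero]
  refine Measure.ext_of_charFun (funext fun a => ?_)
  have hmgf : mgf (fun x => ⟪a, x⟫) μ = mgf (fun x => ⟪a, x⟫) ν := by
    ext t
    simpa only [mgf, real_inner_smul_left] using h (t • a)
  have hset : integrableExpSet (fun x => ⟪a, x⟫) μ = univ := eq_univ_of_forall fun t => by
    simpa only [real_inner_smul_left, integrableExpSet, mem_ofPred_eq] using hμ (t • a)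
  have hcomplex := eqOn_complexMGF_of_mgf' hmgf hzero (x := Complex.I) (by simp [hset])
  simpa only [complexMGF, charFun_apply, real_inner_comm, mul_comm] using hcomplex

variable {μ : Measure E} [IsGaussian μ]

theorem integral_inner_eq_zero (hμ : ∫ x, x ∂μ = 0) (w : E) : ∫ x, ⟪w, x⟫ ∂μ = 0 := by
  simpa [hμ] using IsGaussian.integral_dual (μ := μ) (innerSL ℝ w)

theorem covariance_inner_inner (hμ : ∫ x, x ∂μ = 0) (a b : E) :
    cov[fun x => ⟪a, x⟫, fun x => ⟪b, x⟫; μ] = ⟪covarianceOperator μ a, b⟫ := by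
  rw [covarianceOperator_inner IsGaussian.memLp_two_id, covariance]
  simp [integral_inner_eq_zero hμ]

theorem map_inner_eq_gaussianReal (hμ : ∫ x, x ∂μ = 0) (w : E) :
    μ.map (fun x => ⟪w, x⟫) = gaussianReal 0 (⟪covarianceOperator μ w, w⟫).toNNReal := by
  have h := IsGaussian.map_eq_gaussianReal (μ := μ) (innerSL ℝ w)
  have hw : ⇑(innerSL ℝ w) = fun x => ⟪w, x⟫ := funext (innerSL_apply_apply ℝ w)
  rwa [hw, integral_inner_eq_zero hμ, ← covariance_self (by fun_prop),
    covariance_inner_inner hμ] at h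

theorem integral_exp_inner (hμ : ∫ x, x ∂μ = 0) (w : E) :
    ∫ x, Real.exp ⟪w, x⟫ ∂μ = Real.exp (⟪covarianceOperator μ w, w⟫ / 2) := by
  have h := mgf_gaussianReal (map_inner_eq_gaussianReal hμ w) 1
  rw [Real.coe_toNNReal _ (inner_covarianceOperator_self_nonneg w)] at h
  simpa [mgf] using h

theorem integrable_exp_inner (hμ : ∫ x, x ∂μ = 0) (w : E) :
    Integrable (fun x => Real.exp ⟪w, x⟫) μ :=
  not_imp_comm.1 integral_undef (by rw [integral_exp_inner hμ]; positivity)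

theorem map_neg_eq_self (hμ : ∫ x, x ∂μ = 0) : μ.map (fun x => -x) = μ := by
  refine (measure_ext_of_integral_exp_inner (integrable_exp_inner hμ) fun a => ?_).symm
  rw [integral_map (by fun_prop) (by fun_prop)]
  simp only [inner_neg_right, ← inner_neg_left, integral_exp_inner hμ, map_neg, neg_neg]

theorem map_add_covarianceOperator_eq_tilted (hμ : ∫ x, x ∂μ = 0) (w : E) :
    μ.map (fun x => x + covarianceOperator μ w) = μ.tilted fun x => ⟪w, x⟫ := by
  have hsym (a : E) : ⟪covarianceOperator μ w, a⟫ = ⟪covarianceOperator μ a, w⟫ := by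
    rw [← covariance_inner_inner hμ, ← covariance_inner_inner hμ, covariance_comm]
  refine measure_ext_of_integral_exp_inner (fun a => ?_) fun a => ?_
  · rw [integrable_map_measure (by fun_prop) (by fun_prop)]
    simpa only [Function.comp_def, inner_add_right, Real.exp_add] using
      (integrable_exp_inner hμ a).mul_const _
  · rw [integral_map (by fun_prop) (by fun_prop), integral_exp_tilted]
    simp only [Pi.add_apply, ← inner_add_left]
    simp only [inner_add_right, Real.exp_add, integral_mul_const]
    rw [integral_exp_inner hμ, integral_exp_inner hμ, integral_exp_inner hμ, ← Real.exp_add,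
      ← Real.exp_sub]
    congr 1
    simp only [map_add, inner_add_left, inner_add_right]
    linarith [hsym a, real_inner_comm a (covarianceOperator μ w)]

theorem measure_ball_sub_covarianceOperator (hμ : ∫ x, x ∂μ = 0) (v w : E) (r : ℝ) :
    μ (Metric.ball (v - covarianceOperator μ w) r) =
      ∫⁻ x in Metric.ball v r, ENNReal.ofReal (Real.exp (logShiftDensity μ w x)) ∂μ := by
  have hpre : Metric.ball (v - covarianceOperator μ w) r =
      (fun x => x + covarianceOperator μ w) ⁻¹' Metric.ball v r := by
    ext x
    simp [dist_eq_norm, sub_sub_eq_add_sub]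
  rw [hpre, ← Measure.map_apply (by fun_prop) Metric.isOpen_ball.measurableSet,
    map_add_covarianceOperator_eq_tilted hμ,
    tilted_apply' _ _ Metric.isOpen_ball.measurableSet, integral_exp_inner hμ]
  simp only [logShiftDensity, Real.exp_sub]

theorem measure_ball_neg (hμ : ∫ x, x ∂μ = 0) (v : E) (r : ℝ) :
    μ (Metric.ball (-v) r) = μ (Metric.ball v r) := by
  nth_rw 2 [← map_neg_eq_self hμ]
  rw [Measure.map_apply (by fun_prop) Metric.isOpen_ball.measurableSet]
  congr 1
  ext x
  rw [mem_preimage, Metric.mem_ball, Metric.mem_ball, ← dist_neg_neg, neg_neg]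

end ExponentialMoments

section Anderson

theorem measure_ball_le_of_forall_lt {Y : Type*} [PseudoMetricSpace Y] [MeasurableSpace Y]
    {ν : Measure Y} {v : Y} {r : ℝ} {C : ℝ≥0∞} (h : ∀ s < r, ν (Metric.ball v s) ≤ C) :
    ν (Metric.ball v r) ≤ C := by
  obtain ⟨s, hs, hsr, hlim⟩ := exists_seq_strictMono_tendsto r
  have hunion : Metric.ball v r = ⋃ n, Metric.ball v (s n) := by
    refine Subset.antisymm (fun x hx => ?_)
      (iUnion_subset fun n => Metric.ball_subset_ball (hsr n).le)
    obtain ⟨n, hn⟩ := (hlim.eventually_const_lt (Metric.mem_ball.1 hx)).exists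
    exact mem_iUnion.2 ⟨n, hn⟩
  have hmono : Monotone fun n => Metric.ball v (s n) := fun _ _ hmn =>
    Metric.ball_subset_ball (hs.monotone hmn)
  rw [hunion]
  exact le_of_tendsto' (tendsto_measure_iUnion_atTop hmono) fun n => h _ (hsr n)

theorem measure_sdiff_eq_measure_sdiff {α : Type*} [MeasurableSpace α] {ν : Measure α}
    {A B : Set α} (hA : MeasurableSet A) (hB : MeasurableSet B) (h : ν A = ν B)
    (hfin : ν (A ∩ B) ≠ ∞) : ν (A \ B) = ν (B \ A) := by
  refine (ENNReal.add_right_inj hfin).1 ?_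
  rw [measure_inter_add_sdiff A hB, inter_comm, measure_inter_add_sdiff B hA, h]

theorem withDensity_le_of_le_const {α : Type*} [MeasurableSpace α] {ν : Measure α} {f : α → ℝ≥0∞}
    {A B : Set α} {c : ℝ≥0∞} (hA : MeasurableSet A) (hB : MeasurableSet B) (h : ν A = ν B)
    (hfin : ν (A ∩ B) ≠ ∞) (hle : ∀ x ∉ B, f x ≤ c) (hge : ∀ x ∈ B, c ≤ f x) :
    ν.withDensity f A ≤ ν.withDensity f B := by
  have hdiff : ν.withDensity f (A \ B) ≤ ν.withDensity f (B \ A) := by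
    rw [withDensity_apply _ (hA.diff hB), withDensity_apply _ (hB.diff hA)]
    calc ∫⁻ x in A \ B, f x ∂ν
        ≤ ∫⁻ _ in A \ B, c ∂ν := setLIntegral_mono' (hA.diff hB) fun x hx => hle x hx.2
      _ = ∫⁻ _ in B \ A, c ∂ν := by simp [measure_sdiff_eq_measure_sdiff hA hB h hfin]
      _ ≤ ∫⁻ x in B \ A, f x ∂ν := setLIntegral_mono' (hB.diff hA) fun x hx => hge x hx.1
  rw [← measure_inter_add_sdiff A hB, ← measure_inter_add_sdiff B hA, inter_comm B A]
  gcongr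

theorem gaussianPDF_zero_le_of_abs_le {x z : ℝ} (v : NNReal) (h : |x| ≤ |z|) :
    gaussianPDF 0 v z ≤ gaussianPDF 0 v x := by
  refine ENNReal.ofReal_le_ofReal ?_
  have hsq := sq_le_sq.2 h
  simp only [gaussianPDFReal, sub_zero]
  gcongr

theorem gaussianReal_ball_le (v : NNReal) (a s : ℝ) :
    gaussianReal 0 v (Metric.ball a s) ≤ gaussianReal 0 v (Metric.ball 0 s) := by
  rcases le_or_gt s 0 with hs | hs
  · simp [Metric.ball_eq_empty.2 hs]
  have hball (b : ℝ) : MeasurableSet (Metric.ball b s) := Metric.isOpen_ball.measurableSet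
  rcases eq_or_ne v 0 with rfl | hv
  · rw [gaussianReal_zero_var, Measure.dirac_apply' _ (hball 0),
      indicator_of_mem (Metric.mem_ball_self hs)]
    exact prob_le_one
  rw [gaussianReal_of_var_ne_zero 0 hv]
  refine withDensity_le_of_le_const (c := gaussianPDF 0 v s) (hball a) (hball 0) (by simp)
    (measure_ne_top_of_subset inter_subset_left measure_ball_lt_top.ne)
    (fun x hx => gaussianPDF_zero_le_of_abs_le v ?_)
    fun x hx => gaussianPDF_zero_le_of_abs_le v ?_
  · rw [abs_of_pos hs]
    simpa using hx
  · rw [abs_of_pos hs]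
    simpa using (mem_ball_zero_iff.1 hx).le

section OrthogonalDecomposition

variable {E : Type*} [NormedAddCommGroup E] [InnerProductSpace ℝ E] {e : E}

theorem inner_sub_inner_smul_self_of_norm_eq_one (he : ‖e‖ = 1) (x : E) :
    ⟪e, x - ⟪e, x⟫ • e⟫ = 0 := by
  rw [inner_sub_right, inner_smul_right, real_inner_self_eq_norm_sq, he]
  ring

theorem norm_sq_eq_inner_sq_add_of_norm_eq_one (he : ‖e‖ = 1) (x : E) :
    ‖x‖ ^ 2 = ⟪e, x⟫ ^ 2 + ‖x - ⟪e, x⟫ • e‖ ^ 2 := by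
  rw [norm_sub_sq_real, inner_smul_right, norm_smul, he, real_inner_comm, Real.norm_eq_abs,
    mul_one, sq_abs]
  ring

variable [SecondCountableTopology E] [MeasurableSpace E] [BorelSpace E] {μ : Measure E}
  [IsFiniteMeasure μ]

theorem measure_ball_eq_lintegral_of_indepFun (he : ‖e‖ = 1)
    (hindep : IndepFun (fun x => ⟪e, x⟫) (fun x => x - ⟪e, x⟫ • e) μ) (v : E) {r : ℝ}
    (hr : 0 < r) :
    μ (Metric.ball v r) = ∫⁻ p, μ.map (fun x => ⟪e, x⟫)
      (Metric.ball ⟪e, v⟫ √(r ^ 2 - ‖p - (v - ⟪e, v⟫ • e)‖ ^ 2))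
        ∂μ.map (fun x => x - ⟪e, x⟫ • e) := by
  set s : Set (ℝ × E) := {z | (z.1 - ⟪e, v⟫) ^ 2 + ‖z.2 - (v - ⟪e, v⟫ • e)‖ ^ 2 < r ^ 2}
  have hsm : MeasurableSet s := (isOpen_lt (by fun_prop) (by fun_prop)).measurableSet
  have hball : Metric.ball v r = (fun x => (⟪e, x⟫, x - ⟪e, x⟫ • e)) ⁻¹' s := by
    ext x
    have hsplit : x - v - ⟪e, x - v⟫ • e = x - ⟪e, x⟫ • e - (v - ⟪e, v⟫ • e) := by
      rw [inner_sub_right, sub_smul]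
      abel
    rw [mem_ball_iff_norm, ← sq_lt_sq₀ (norm_nonneg _) hr.le,
      norm_sq_eq_inner_sq_add_of_norm_eq_one he, hsplit, inner_sub_right]
    rfl
  have hprod : μ.map (fun x => (⟪e, x⟫, x - ⟪e, x⟫ • e)) =
      (μ.map fun x => ⟪e, x⟫).prod (μ.map fun x => x - ⟪e, x⟫ • e) :=
    (indepFun_iff_map_prod_eq_prod_map_map (by fun_prop) (by fun_prop)).1 hindep
  rw [hball, ← Measure.map_apply (by fun_prop) hsm, hprod, Measure.prod_apply_symm hsm]
  refine lintegral_congr fun p => congrArg _ ?_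
  ext t
  rw [Metric.mem_ball, Real.dist_eq, Real.lt_sqrt (abs_nonneg _), sq_abs, lt_sub_iff_add_lt]
  rfl

end OrthogonalDecomposition

variable {E : Type*} [NormedAddCommGroup E] [InnerProductSpace ℝ E] [CompleteSpace E]
  [SecondCountableTopology E] [MeasurableSpace E] [BorelSpace E] {μ : Measure E} [IsGaussian μ]

theorem indepFun_inner_sub_of_eigenvector (hμ : ∫ x, x ∂μ = 0) {e : E} (he : ‖e‖ = 1) {c : ℝ}
    (hc : covarianceOperator μ e = c • e) :
    IndepFun (fun x => ⟪e, x⟫) (fun x => x - ⟪e, x⟫ • e) μ := by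
  refine HasGaussianLaw.indepFun_of_covariance_inner ?_ fun t x => ?_
  · exact (IsGaussian.hasGaussianLaw_id (μ := μ)).map
      ((innerSL ℝ e).prod (.id ℝ E - (innerSL ℝ e).smulRight e))
  · have hcoord : (fun z => ⟪t, ⟪e, z⟫⟫) = fun z => ⟪t • e, z⟫ := by
      ext z
      simp [inner_smul_left, mul_comm]
    have hresidual : (fun z => ⟪x, z - ⟪e, z⟫ • e⟫) = fun z => ⟪x - ⟪e, x⟫ • e, z⟫ := by
      ext z
      rw [inner_sub_right, inner_sub_left, real_inner_smul_left, real_inner_smul_right,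
        real_inner_comm e x, mul_comm]
    rw [hcoord, hresidual, covariance_inner_inner hμ, map_smul, hc, real_inner_smul_left,
      real_inner_smul_left, inner_sub_inner_smul_self_of_norm_eq_one he, mul_zero, mul_zero]

theorem measure_ball_le_of_eigenvector (hμ : ∫ x, x ∂μ = 0) {e : E} (he : ‖e‖ = 1) {c : ℝ}
    (hc : covarianceOperator μ e = c • e) (v : E) (r : ℝ) :
    μ (Metric.ball v r) ≤ μ (Metric.ball (v - ⟪e, v⟫ • e) r) := by
  rcases le_or_gt r 0 with hr | hr
  · simp [Metric.ball_eq_empty.2 hr]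
  have hindep := indepFun_inner_sub_of_eigenvector hμ he hc
  rw [measure_ball_eq_lintegral_of_indepFun he hindep _ hr,
    measure_ball_eq_lintegral_of_indepFun he hindep _ hr,
    inner_sub_inner_smul_self_of_norm_eq_one he, zero_smul, sub_zero,
    map_inner_eq_gaussianReal hμ e]
  exact lintegral_mono fun p => gaussianReal_ball_le _ _ _

theorem measure_ball_le_of_finiteDimensional [FiniteDimensional ℝ E] (hμ : ∫ x, x ∂μ = 0)
    (v : E) (r : ℝ) : μ (Metric.ball v r) ≤ μ (Metric.ball 0 r) := by
  have hsym : (covarianceOperator μ).toLinearMap.IsSymmetric :=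
    isPositive_covarianceOperator.isSymmetric
  set b := hsym.eigenvectorBasis rfl
  have hremove (t : Finset (Fin (Module.finrank ℝ E))) :
      μ (Metric.ball v r) ≤ μ (Metric.ball (v - ∑ i ∈ t, ⟪b i, v⟫ • b i) r) := by
    induction t using Finset.induction_on with
    | empty => simp
    | insert i t hi ih =>
      refine ih.trans ((measure_ball_le_of_eigenvector hμ (b.norm_eq_one i)
        (c := hsym.eigenvalues rfl i) (hsym.apply_eigenvectorBasis rfl i) _ r).trans_eq ?_)
      have horth : ⟪b i, ∑ j ∈ t, ⟪b j, v⟫ • b j⟫ = 0 := by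
        rw [inner_sum]
        refine Finset.sum_eq_zero fun j hj => ?_
        rw [inner_smul_right, b.inner_eq_zero (by rintro rfl; exact hi hj), mul_zero]
      rw [inner_sub_right, horth, sub_zero, Finset.sum_insert hi, sub_sub, add_comm]
  simpa only [b.sum_repr' v, sub_self] using hremove Finset.univ

theorem measure_ball_le_measure_norm_starProjection_le (hμ : ∫ x, x ∂μ = 0) (U : Submodule ℝ E)
    [FiniteDimensional ℝ U] (v : E) (r : ℝ) :
    μ (Metric.ball v r) ≤ μ {x | ‖U.starProjection x‖ ≤ r} := by
  have hmeas : Measurable U.orthogonalProjectionOnto :=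
    U.orthogonalProjectionOnto.continuous.measurable
  have hcentered : ∫ x, x ∂μ.map U.orthogonalProjectionOnto = 0 := by
    rw [integral_map hmeas.aemeasurable (by fun_prop),
      ContinuousLinearMap.integral_comp_comm _ IsGaussian.integrable_fun_id, hμ, map_zero]
  have hball (x : U) : MeasurableSet (Metric.ball x r) := Metric.isOpen_ball.measurableSet
  calc μ (Metric.ball v r)
      ≤ μ (U.orthogonalProjectionOnto ⁻¹' Metric.ball (U.orthogonalProjectionOnto v) r) := by
        refine measure_mono fun x hx => ?_
        rw [mem_ball_iff_norm] at hx
        rw [mem_preimage, mem_ball_iff_norm, ← map_sub]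
        exact (U.norm_orthogonalProjectionOnto_apply_le _).trans_lt hx
    _ ≤ μ (U.orthogonalProjectionOnto ⁻¹' Metric.ball 0 r) := by
        rw [← Measure.map_apply hmeas (hball _), ← Measure.map_apply hmeas (hball _)]
        exact measure_ball_le_of_finiteDimensional hcentered _ r
    _ ≤ μ {x | ‖U.starProjection x‖ ≤ r} :=
        measure_mono fun x hx => (mem_ball_zero_iff.1 hx).le

theorem exists_monotone_finiteDimensional_dense (E : Type*) [NormedAddCommGroup E]
    [NormedSpace ℝ E] [TopologicalSpace.SeparableSpace E] :
    ∃ U : ℕ → Submodule ℝ E, Monotone U ∧ (∀ n, FiniteDimensional ℝ (U n)) ∧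
      ⊤ ≤ (⨆ n, U n).topologicalClosure := by
  refine ⟨fun n => Submodule.span ℝ (TopologicalSpace.denseSeq E '' Iic n),
    fun m n h => Submodule.span_mono (image_mono (Iic_subset_Iic.2 h)),
    fun n => FiniteDimensional.span_of_finite ℝ ((finite_Iic n).image _), fun x _ => ?_⟩
  refine closure_mono ?_ (TopologicalSpace.denseRange_denseSeq E x)
  rintro _ ⟨n, rfl⟩
  exact le_iSup (fun n => Submodule.span ℝ (TopologicalSpace.denseSeq E '' Iic n)) n
    (Submodule.subset_span ⟨n, self_mem_Iic, rfl⟩)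

theorem measure_ball_le_measure_ball_zero (hμ : ∫ x, x ∂μ = 0) (v : E) (r : ℝ) :
    μ (Metric.ball v r) ≤ μ (Metric.ball 0 r) := by
  obtain ⟨U, hmono, hfin, hdense⟩ := exists_monotone_finiteDimensional_dense E
  refine measure_ball_le_of_forall_lt fun s hs => ?_
  have hanti : Antitone fun n => {x | ‖(U n).starProjection x‖ ≤ s} := fun m n hmn x hx => by
    refine le_trans ?_ (mem_ofPred_eq.mp hx)
    rw [Submodule.starProjection_apply,
      ← Submodule.orthogonalProjectionOnto_starProjection_of_le (hmono hmn)]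
    exact (U m).norm_starProjection_apply_le _
  have hlim := tendsto_measure_iInter_atTop (μ := μ) (fun n =>
    (isClosed_le (by fun_prop) continuous_const).measurableSet.nullMeasurableSet) hanti
    ⟨0, measure_ne_top _ _⟩
  refine (ge_of_tendsto' hlim fun n =>
    measure_ball_le_measure_norm_starProjection_le hμ (U n) v s).trans (measure_mono fun x hx => ?_)
  rw [mem_iInter] at hx
  exact mem_ball_zero_iff.2 ((le_of_tendsto'
    (Submodule.starProjection_tendsto_self U hmono x hdense).norm hx).trans_lt hs)

end Anderson

section SmallBalls

theorem exists_mem_closure_range_apply_eq_norm_le {E : Type*} [NormedAddCommGroup E]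
    [InnerProductSpace ℝ E] [CompleteSpace E] {S : E →L[ℝ] E} (hS : IsSelfAdjoint S) (x : E) :
    ∃ p ∈ closure (range S), S p = S x ∧ ‖p‖ ≤ ‖x‖ := by
  set V := S.range.topologicalClosure
  have : CompleteSpace V := S.range.isClosed_topologicalClosure.completeSpace_coe
  refine ⟨V.starProjection x, V.starProjection_apply_mem x, ?_, V.norm_starProjection_apply_le x⟩
  rw [eq_comm, ← sub_eq_zero, ← map_sub, ← inner_self_eq_zero (𝕜 := ℝ),
    hS.isSymmetric.apply_clm, real_inner_comm]
  exact V.sub_starProjection_mem_orthogonal x _ (S.range.le_topologicalClosure ⟨_, rfl⟩)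

variable {E : Type*} [NormedAddCommGroup E] [InnerProductSpace ℝ E] [CompleteSpace E]
  [SecondCountableTopology E] [MeasurableSpace E] [BorelSpace E] {μ : Measure E} [IsGaussian μ]

theorem exp_logShiftDensity_sub_mul_measure_ball_le (hμ : ∫ x, x ∂μ = 0) (v w : E) (r : ℝ) :
    ENNReal.ofReal (Real.exp (logShiftDensity μ w v - r * ‖w‖)) * μ (Metric.ball v r) ≤
      μ (Metric.ball 0 r) := by
  refine le_trans ?_ (measure_ball_le_measure_ball_zero hμ (v - covarianceOperator μ w) r)
  rw [measure_ball_sub_covarianceOperator hμ, ← setLIntegral_const]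
  refine setLIntegral_mono' Metric.isOpen_ball.measurableSet fun x hx => ?_
  have hinner : ⟪w, v - x⟫ ≤ r * ‖w‖ := by
    rw [Metric.mem_ball', dist_eq_norm] at hx
    refine (real_inner_le_norm _ _).trans ?_
    rw [mul_comm]
    gcongr
  rw [inner_sub_right] at hinner
  refine ENNReal.ofReal_le_ofReal (Real.exp_le_exp.2 ?_)
  simp only [logShiftDensity]
  linarith

theorem exp_norm_sub_mul_measure_ball_le (hμ : ∫ x, x ∂μ = 0) (v : E) {r : ℝ} (hr : 0 ≤ r) :
    ENNReal.ofReal (Real.exp (‖v‖ - ‖covarianceOperator μ‖ / 2 - r)) * μ (Metric.ball v r) ≤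
      μ (Metric.ball 0 r) := by
  set w := ‖v‖⁻¹ • v with hw
  have hw1 : ‖w‖ ≤ 1 := by
    rw [hw, norm_smul, norm_inv, norm_norm]
    exact inv_mul_le_one
  have hwv : ⟪w, v⟫ = ‖v‖ := by
    rw [hw, real_inner_smul_left, real_inner_self_eq_norm_sq]
    rcases eq_or_ne ‖v‖ 0 with h0 | h0
    · simp [h0]
    · field_simp
  have hK : ⟪covarianceOperator μ w, w⟫ ≤ ‖covarianceOperator μ‖ :=
    calc ⟪covarianceOperator μ w, w⟫
        ≤ ‖covarianceOperator μ w‖ * ‖w‖ := real_inner_le_norm _ _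
      _ ≤ ‖covarianceOperator μ‖ * 1 * 1 := by
        gcongr
        exact (covarianceOperator μ).le_opNorm_of_le hw1
      _ = ‖covarianceOperator μ‖ := by ring
  refine le_trans ?_ (exp_logShiftDensity_sub_mul_measure_ball_le hμ v w r)
  have := mul_le_of_le_one_right hr hw1
  gcongr
  simp only [logShiftDensity]
  linarith

theorem eventually_exp_mul_measure_ball_le_of_isCompact (hμ : ∫ x, x ∂μ = 0) {C : Set E}
    (hC : IsCompact ((toWeakSpace ℝ E).symm ⁻¹' C)) {b : ℝ}
    (hb : ∀ v ∈ C, ∃ w, b < logShiftDensity μ w v) :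
    ∀ᶠ r in 𝓝 (0 : ℝ), ∀ v ∈ C,
      ENNReal.ofReal (Real.exp b) * μ (Metric.ball v r) ≤ μ (Metric.ball 0 r) := by
  refine hC.eventually_forall_of_forall_eventually
    (P := fun r v => ENNReal.ofReal (Real.exp b) *
      μ (Metric.ball ((toWeakSpace ℝ E).symm v) r) ≤ μ (Metric.ball 0 r)) fun v hv => ?_
  obtain ⟨w, hw⟩ := hb ((toWeakSpace ℝ E).symm v) hv
  have hcont : Continuous fun z : ℝ × WeakSpace ℝ E =>
      logShiftDensity μ w ((toWeakSpace ℝ E).symm z.2) - z.1 * ‖w‖ :=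
    (((continuous_inner_toWeakSpace_symm w).comp continuous_snd).sub continuous_const).sub
      (continuous_fst.mul_const _)
  filter_upwards [(hcont.tendsto' (0, v) _ (by simp)).eventually_const_lt hw] with z hz
  refine le_trans ?_
    (exp_logShiftDensity_sub_mul_measure_ball_le hμ ((toWeakSpace ℝ E).symm z.2) w z.1)
  gcongr

theorem eventually_exp_mul_measure_ball_le (hμ : ∫ x, x ∂μ = 0) {C : Set E}
    (hC : IsClosed ((toWeakSpace ℝ E).symm ⁻¹' C)) {b : ℝ}
    (hb : ∀ v ∈ C, ∃ w, b < logShiftDensity μ w v) :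
    ∀ᶠ r in 𝓝[>] (0 : ℝ), ∀ v ∈ C,
      ENNReal.ofReal (Real.exp b) * μ (Metric.ball v r) ≤ μ (Metric.ball 0 r) := by
  set R := b + ‖covarianceOperator μ‖ / 2 + 1 with hR
  have hbounded := eventually_exp_mul_measure_ball_le_of_isCompact hμ
    (C := C ∩ Metric.closedBall 0 R)
    ((isCompact_toWeakSpace_symm_preimage_closedBall R).inter_left hC) fun v hv => hb v hv.1
  filter_upwards [hbounded.filter_mono nhdsWithin_le_nhds, Ioc_mem_nhdsGT (zero_lt_one' ℝ)]
    with r hr hr1 v hv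
  rcases le_or_gt ‖v‖ R with hvR | hvR
  · exact hr v ⟨hv, mem_closedBall_zero_iff.2 hvR⟩
  · refine le_trans ?_ (exp_norm_sub_mul_measure_ball_le hμ v hr1.1.le)
    gcongr
    linarith [hr1.2]

-- Averaging the shifts by `𝒦 w` and `-𝒦 w` replaces the exponential of the linear term by `cosh`.
theorem exp_neg_mul_measure_ball_zero_le_covarianceOperator (hμ : ∫ x, x ∂μ = 0) (w : E) (r : ℝ) :
    ENNReal.ofReal (Real.exp (-(⟪covarianceOperator μ w, w⟫ / 2))) * μ (Metric.ball 0 r) ≤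
      μ (Metric.ball (covarianceOperator μ w) r) := by
  have hshift := measure_ball_sub_covarianceOperator hμ 0 w r
  have hshift_neg := measure_ball_sub_covarianceOperator hμ 0 (-w) r
  rw [zero_sub, measure_ball_neg hμ] at hshift
  rw [map_neg, zero_sub, neg_neg] at hshift_neg
  refine (ENNReal.mul_le_mul_iff_right two_ne_zero ENNReal.ofNat_ne_top).1 ?_
  rw [two_mul (μ _)]
  nth_rw 1 [hshift]
  rw [hshift_neg, ← lintegral_add_left (by unfold logShiftDensity; fun_prop), ← mul_assoc,
    ← setLIntegral_const]
  refine lintegral_mono fun x => ?_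
  rw [← ENNReal.ofReal_add (Real.exp_pos _).le (Real.exp_pos _).le,
    ← ENNReal.ofReal_ofNat 2, ← ENNReal.ofReal_mul zero_le_two]
  refine ENNReal.ofReal_le_ofReal ?_
  have hcosh := Real.one_le_cosh ⟪w, x⟫
  rw [Real.cosh_eq] at hcosh
  simp only [logShiftDensity, map_neg, inner_neg_left, inner_neg_right, neg_neg, sub_eq_add_neg,
    Real.exp_add, ← add_mul]
  gcongr
  linarith

theorem exp_neg_mul_measure_ball_zero_le_of_mem_closure (hμ : ∫ x, x ∂μ = 0) {x : E}
    (hx : x ∈ closure (range (covarianceSqrt μ))) (r : ℝ) :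
    ENNReal.ofReal (Real.exp (-(‖x‖ ^ 2 / 2))) * μ (Metric.ball 0 r) ≤
      μ (Metric.ball (covarianceSqrt μ x) r) := by
  set c : E → ℝ≥0∞ := fun z => ENNReal.ofReal (Real.exp (-(‖z‖ ^ 2 / 2)))
  have hc : Continuous c := ENNReal.continuous_ofReal.comp (by fun_prop)
  refine measure_ball_le_of_forall_lt (ν := c x • μ) fun s hs => ?_
  obtain ⟨z, hz, hlim⟩ := mem_closure_iff_seq_limit.1 hx
  choose w hw using hz
  have hball := ((covarianceSqrt μ).continuous.tendsto x).comp hlim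
  refine le_of_tendsto (((ENNReal.continuous_mul_const (measure_ne_top _ _)).comp hc).tendsto x
    |>.comp hlim) ?_
  filter_upwards [hball (Metric.ball_mem_nhds _ (sub_pos.2 hs))] with n hn
  have h := exp_neg_mul_measure_ball_zero_le_covarianceOperator hμ (w n) s
  rw [inner_covarianceOperator_self, ← covarianceSqrt_comp_self, ContinuousLinearMap.comp_apply,
    hw] at h
  refine h.trans (measure_mono (Metric.ball_subset_ball' ?_))
  have : dist (covarianceSqrt μ (z n)) (covarianceSqrt μ x) < r - s := hn
  linarith

theorem exp_neg_mul_measure_ball_zero_le_covarianceSqrt (hμ : ∫ x, x ∂μ = 0) (x : E) (r : ℝ) :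
    ENNReal.ofReal (Real.exp (-(‖x‖ ^ 2 / 2))) * μ (Metric.ball 0 r) ≤
      μ (Metric.ball (covarianceSqrt μ x) r) := by
  obtain ⟨p, hp, hpx, hnorm⟩ :=
    exists_mem_closure_range_apply_eq_norm_le (covarianceSqrt_isPositive μ).isSelfAdjoint x
  rw [← hpx]
  refine le_trans ?_ (exp_neg_mul_measure_ball_zero_le_of_mem_closure hμ hp r)
  gcongr

theorem exp_neg_mul_measure_ball_zero_le (hμ : ∫ x, x ∂μ = 0) {u : E}
    (hu : cameronMartinNorm μ u ≠ ∞) (r : ℝ) :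
    ENNReal.ofReal (Real.exp (-((cameronMartinNorm μ u).toReal ^ 2 / 2))) * μ (Metric.ball 0 r) ≤
      μ (Metric.ball u r) := by
  set a := (cameronMartinNorm μ u).toReal
  have hcont : Continuous fun b : ℝ =>
      ENNReal.ofReal (Real.exp (-(b ^ 2 / 2))) * μ (Metric.ball 0 r) :=
    (ENNReal.continuous_mul_const (measure_ne_top _ _)).comp
      (ENNReal.continuous_ofReal.comp (by fun_prop))
  refine le_of_tendsto ((hcont.tendsto a).mono_left (nhdsWithin_le_nhds (s := Ioi a))) ?_
  filter_upwards [self_mem_nhdsWithin] with b hab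
  have hb : cameronMartinNorm μ u < ENNReal.ofReal b := (ENNReal.lt_ofReal_iff_toReal_lt hu).2 hab
  simp only [cameronMartinNorm, iInf_lt_iff] at hb
  obtain ⟨x, rfl, hxb⟩ := hb
  rw [← ofReal_norm, ENNReal.ofReal_lt_ofReal_iff (ENNReal.toReal_nonneg.trans_lt hab)] at hxb
  refine le_trans ?_ (exp_neg_mul_measure_ball_zero_le_covarianceSqrt hμ x r)
  gcongr

theorem mem_support_of_cameronMartinNorm_ne_top (hμ : ∫ x, x ∂μ = 0) {u : E}
    (hu : cameronMartinNorm μ u ≠ ∞) : u ∈ μ.support := by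
  obtain ⟨v, hv⟩ := Measure.nonempty_support (IsProbabilityMeasure.ne_zero μ)
  refine (Measure.mem_support_iff_forall u).2 fun U hU => ?_
  obtain ⟨r, hr, hrU⟩ := Metric.mem_nhds_iff.1 hU
  have hzero : 0 < μ (Metric.ball 0 r) :=
    ((Measure.mem_support_iff_forall v).1 hv _ (Metric.ball_mem_nhds v hr)).trans_le
      (measure_ball_le_measure_ball_zero hμ v r)
  exact (ENNReal.mul_pos (by positivity) hzero.ne').trans_le
    ((exp_neg_mul_measure_ball_zero_le hμ hu r).trans (measure_mono hrU))

end SmallBalls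

section ConditionalModes

theorem mem_support_map {X Z : Type*} [TopologicalSpace X] [MeasurableSpace X] [TopologicalSpace Z]
    [MeasurableSpace Z] {ν : Measure X} {T : X → Z} {x : X} (hT : ContinuousAt T x)
    (hTm : AEMeasurable T ν) (hx : x ∈ ν.support) : T x ∈ (ν.map T).support := by
  refine (Measure.mem_support_iff_forall _).2 fun U hU => ?_
  exact ((Measure.mem_support_iff_forall x).1 hx _ (hT.preimage_mem_nhds hU)).trans_le
    (Measure.le_map_apply hTm U)

theorem tendsto_div_iSup_nhds_one {α β : Type*} {l : Filter α} {f : β → α → ℝ≥0∞} {S : Set β}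
    {u : β} (hu : u ∈ S) (hzero : ∀ᶠ r in l, f u r ≠ 0) (htop : ∀ᶠ r in l, ⨆ v ∈ S, f v r ≠ ∞)
    (h : ∀ c < 1, ∀ᶠ r in l, ∀ v ∈ S, c * f v r ≤ f u r) :
    Tendsto (fun r => f u r / ⨆ v ∈ S, f v r) l (𝓝 1) := by
  have hle (r : α) : f u r ≤ ⨆ v ∈ S, f v r := le_iSup₂ (f := fun v (_ : v ∈ S) => f v r) u hu
  refine tendsto_order.2 ⟨fun c hc => ?_, fun c hc => .of_forall fun r => ?_⟩
  · obtain ⟨d, hcd, hd⟩ := exists_between hc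
    filter_upwards [hzero, htop, h d hd] with r hzero htop h
    refine hcd.trans_le ((ENNReal.le_div_iff_mul_le
      (.inl ((pos_iff_ne_zero.2 hzero).trans_le (hle r)).ne') (.inl htop)).2 ?_)
    simpa only [ENNReal.mul_iSup, iSup_le_iff] using h
  · exact (ENNReal.div_le_of_le_mul ((hle r).trans_eq (one_mul _).symm)).trans_lt hc

variable {E : Type*} [NormedAddCommGroup E] [InnerProductSpace ℝ E] [CompleteSpace E]
  [SecondCountableTopology E] [MeasurableSpace E] [BorelSpace E] {μ : Measure E} [IsGaussian μ]

theorem IsConditionalMode.logShiftDensity_le (hμ : ∫ x, x ∂μ = 0) {Y : Type*}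
    [TopologicalSpace Y] [MeasurableSpace Y] {T : E → Y} {y : Y} {u : E}
    (h : IsConditionalMode μ T y u) {v : E} (hv : T v = y) (hvtop : cameronMartinNorm μ v ≠ ∞)
    (w : E) : logShiftDensity μ w u ≤ (cameronMartinNorm μ v).toReal ^ 2 / 2 := by
  set a := (cameronMartinNorm μ v).toReal
  set c : ℝ → ℝ≥0∞ := fun r =>
    ENNReal.ofReal (Real.exp (-(a ^ 2 / 2))) *
      ENNReal.ofReal (Real.exp (logShiftDensity μ w u - r * ‖w‖))
  have hle (r : ℝ) : c r * (μ (Metric.ball u r) / ⨆ x ∈ T ⁻¹' {y}, μ (Metric.ball x r)) ≤ 1 := by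
    rw [← mul_div_assoc]
    refine ENNReal.div_le_of_le_mul ?_
    calc c r * μ (Metric.ball u r)
        ≤ ENNReal.ofReal (Real.exp (-(a ^ 2 / 2))) * μ (Metric.ball 0 r) := by
          rw [mul_assoc]
          gcongr
          exact exp_logShiftDensity_sub_mul_measure_ball_le hμ u w r
      _ ≤ μ (Metric.ball v r) := exp_neg_mul_measure_ball_zero_le hμ hvtop r
      _ ≤ 1 * ⨆ x ∈ T ⁻¹' {y}, μ (Metric.ball x r) := by
          rw [one_mul]
          exact le_iSup₂ (f := fun x (_ : x ∈ T ⁻¹' {y}) => μ (Metric.ball x r)) v hv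
  have hc : Tendsto c (𝓝[>] 0)
      (𝓝 (ENNReal.ofReal (Real.exp (-(a ^ 2 / 2) + logShiftDensity μ w u)))) := by
    simp only [c, ← ENNReal.ofReal_mul (Real.exp_pos _).le, ← Real.exp_add]
    refine Tendsto.mono_left (Continuous.tendsto' ?_ 0 _ (by simp)) nhdsWithin_le_nhds
    exact ENNReal.continuous_ofReal.comp (by fun_prop)
  have hlim := le_of_tendsto' (ENNReal.Tendsto.mul hc (.inr ENNReal.one_ne_top) h.2.2
    (.inr ENNReal.ofReal_ne_top)) hle
  rw [mul_one, ENNReal.ofReal_le_one, Real.exp_le_one_iff] at hlim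
  linarith

theorem IsConditionalMode.isConstrainedMinimizer (hμ : ∫ x, x ∂μ = 0) {Y : Type*}
    [TopologicalSpace Y] [MeasurableSpace Y] {T : E → Y} {y : Y} {u : E}
    (h : IsConditionalMode μ T y u) : IsConstrainedMinimizer μ T y u := by
  refine ⟨h.2.1, fun v hv => ?_⟩
  by_cases hvtop : cameronMartinNorm μ v = ∞
  · exact hvtop ▸ le_top
  · rw [← ENNReal.ofReal_toReal hvtop]
    exact cameronMartinNorm_le_ofReal ENNReal.toReal_nonneg (h.logShiftDensity_le hμ hv hvtop)

theorem IsConstrainedMinimizer.eventually_mul_measure_ball_le (hμ : ∫ x, x ∂μ = 0) {Y : Type*}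
    {T : E → Y} {y : Y} {u : E} (h : IsConstrainedMinimizer μ T y u)
    (hu : cameronMartinNorm μ u ≠ ∞) (hT : IsClosed ((toWeakSpace ℝ E).symm ⁻¹' (T ⁻¹' {y})))
    {c : ℝ≥0∞} (hc : c < 1) :
    ∀ᶠ r in 𝓝[>] (0 : ℝ), ∀ v ∈ T ⁻¹' {y}, c * μ (Metric.ball v r) ≤ μ (Metric.ball u r) := by
  set a := (cameronMartinNorm μ u).toReal
  have hexp : Tendsto (fun b : ℝ => ENNReal.ofReal (Real.exp (b - a ^ 2 / 2)))
      (𝓝[<] (a ^ 2 / 2)) (𝓝 1) :=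
    Tendsto.mono_left (Continuous.tendsto' (ENNReal.continuous_ofReal.comp (by fun_prop)) _ _
      (by simp)) nhdsWithin_le_nhds
  obtain ⟨b, hcb, hb⟩ := ((hexp.eventually_const_lt hc).and self_mem_nhdsWithin).exists
  have hdual (v : E) (hv : v ∈ T ⁻¹' {y}) : ∃ w, b < logShiftDensity μ w v :=
    exists_lt_logShiftDensity ENNReal.toReal_nonneg
      ((ENNReal.ofReal_toReal hu).trans_le (h.2 v hv)) hb
  filter_upwards [eventually_exp_mul_measure_ball_le hμ hT hdual] with r hr v hv
  calc c * μ (Metric.ball v r)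
      ≤ ENNReal.ofReal (Real.exp (b - a ^ 2 / 2)) * μ (Metric.ball v r) := by gcongr
    _ = ENNReal.ofReal (Real.exp (-(a ^ 2 / 2))) *
          (ENNReal.ofReal (Real.exp b) * μ (Metric.ball v r)) := by
      rw [← mul_assoc, ← ENNReal.ofReal_mul (Real.exp_pos _).le, ← Real.exp_add, neg_add_eq_sub]
    _ ≤ ENNReal.ofReal (Real.exp (-(a ^ 2 / 2))) * μ (Metric.ball 0 r) := by
      gcongr
      exact hr v hv
    _ ≤ μ (Metric.ball u r) := exp_neg_mul_measure_ball_zero_le hμ hu r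

variable {Z : Type*} [TopologicalSpace Z] [T1Space Z] [MeasurableSpace Z] [BorelSpace Z]
  {T : E → Z} {y : Z} {u : E}

theorem IsConstrainedMinimizer.isConditionalMode (hμ : ∫ x, x ∂μ = 0)
    (hT : Continuous (T ∘ (toWeakSpace ℝ E).symm)) (hu : cameronMartinNorm μ u ≠ ∞)
    (h : IsConstrainedMinimizer μ T y u) : IsConditionalMode μ T y u := by
  have hTc : Continuous T := hT.comp (toWeakSpaceCLM ℝ E).continuous
  have hsupp := mem_support_of_cameronMartinNorm_ne_top hμ hu
  refine ⟨h.1 ▸ mem_support_map hTc.continuousAt hTc.aemeasurable hsupp, h.1, ?_⟩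
  refine tendsto_div_iSup_nhds_one (f := fun v r => μ (Metric.ball v r)) h.1 ?_
    (.of_forall fun r => ?_)
    fun c hc => h.eventually_mul_measure_ball_le hμ hu (isClosed_singleton.preimage hT) hc
  · filter_upwards [self_mem_nhdsWithin] with r hr
    exact ((Measure.mem_support_iff_forall u).1 hsupp _ (Metric.ball_mem_nhds u hr)).ne'
  · exact ne_top_of_le_ne_top ENNReal.one_ne_top (iSup₂_le fun _ _ => prob_le_one)

theorem mainTheorem8_general (μ : Measure E) [IsGaussian μ] (hμ : ∫ x, x ∂μ = 0) (T : E → Z)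
    (hT : Continuous (T ∘ (toWeakSpace ℝ E).symm)) (y : Z)
    (hy : y ∈ T '' (cameronMartinSpace μ : Set E)) (u : E) :
    IsConditionalMode μ T y u ↔ IsConstrainedMinimizer μ T y u := by
  obtain ⟨v, hv, hvy⟩ := hy
  exact ⟨fun h => h.isConstrainedMinimizer hμ, fun h => h.isConditionalMode hμ hT
    (ne_top_of_le_ne_top (cameronMartinNorm_ne_top hv) (h.2 v hvy))⟩

end ConditionalModes

theorem LipschitzOnBalls.continuous {E E' : Type*} [NormedAddCommGroup E] [NormedAddCommGroup E']
    {F : E → E'} (hF : LipschitzOnBalls F) : Continuous F := by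
  refine continuous_iff_continuousAt.2 fun z => ?_
  obtain ⟨L, hL, h⟩ := hF (‖z‖ + 1) (by positivity)
  have hLip : LipschitzOnWith L.toNNReal F (Metric.ball 0 (‖z‖ + 1)) := by
    refine LipschitzOnWith.of_dist_le_mul fun x hx w hw => ?_
    rw [dist_eq_norm, dist_eq_norm, Real.coe_toNNReal _ hL.le]
    exact h x hx w hw
  exact hLip.continuousOn.continuousAt (Metric.isOpen_ball.mem_nhds (by simp))

theorem continuous_observation_comp_toWeakSpace_symm {X : Type*} [NormedAddCommGroup X]
    [InnerProductSpace ℝ X] {N : ℕ} (φ : Fin N → StrongDual ℝ X) :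
    Continuous (observation φ ∘ (toWeakSpace ℝ X).symm) :=
  (PiLp.continuous_toLp 2 _).comp
    (continuous_pi fun i => WeakBilin.eval_continuous _ (φ i))

theorem mainTheorem8 {X : Type*} [NormedAddCommGroup X] [InnerProductSpace ℝ X] [CompleteSpace X]
    [SecondCountableTopology X] [MeasurableSpace X] [BorelSpace X]
    (μ : Measure X) [IsGaussian μ] (hμ : ∫ x, x ∂μ = 0)
    {N M : ℕ} (φ : Fin N → StrongDual ℝ X)
    (F : EuclideanSpace ℝ (Fin N) → EuclideanSpace ℝ (Fin M)) (hF : LipschitzOnBalls F)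
    (y : EuclideanSpace ℝ (Fin M))
    (hy : y ∈ (fun u => F (observation φ u)) '' (cameronMartinSpace μ : Set X))
    (u : X) :
    IsConditionalMode μ (fun v => F (observation φ v)) y u ↔
      IsConstrainedMinimizer μ (fun v => F (observation φ v)) y u :=
  mainTheorem8_general μ hμ _ (hF.continuous.comp (continuous_observation_comp_toWeakSpace_symm φ))
    y hy u
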